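/- Let $G$ be a finite loopless graph in which parallel edges are allowed. A cycle of $G$ is a closed walk of length at least $2$ with no repeated edge and with no repeated vertex except that its first and last vertices agree (so two parallel edges form a cycle of length $2$). For $S\subseteq V(G)$ let $I(S)$ be the union of $S$ and the set of all vertices $v$ such that the induced subgraph $G[S\cup\{v\}]$ contains a cycle through $v$. A set $S\subseteq V(G)$ is convex if $I(S)=S$, and the convex hull of $S\subseteq V(G)$ is the smallest convex set containing $S$. A hull set is a set $S\subseteq V(G)$ whose convex hull is $V(G)$, and the hull number $\mathrm{hn}(G)$ in the cycle convexity is the smallest cardinality of a hull set of $G$. The graph $G$ is $4$-regular if every vertex is an end of exactly four edges, counted with multiplicity, and it is planar if it can be drawn in the Euclidean plane so that distinct vertices are distinct points, every edge is a simple polygonal curve joining its ends and meeting no other vertex, and the curves of distinct edges meet only in common ends. **Theorem.** If $G$ is a $4$-regular planar graph (finite, loopless, parallel edges allowed), then $$\mathrm{hn}(G)\le \tfrac12\,|V(G)|.$$ Furthermore, this bound is tight: there is a $4$-regular planar loopless graph with exactly two vertices for which equality holds. -/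

import Mathlib

/-! Finite multigraphs are modelled by Mathlib's `Graph α β`: a vertex set `G.vertexSet : Set α`, an
edge set `G.edgeSet : Set β` (parallel edges are distinct elements of `β`), and the incidence
predicate `G.IsLink e x y` saying that `x` and `y` are the ends of the edge `e`. -/

/-- The Euclidean plane. -/
abbrev Plane : Type := EuclideanSpace ℝ (Fin 2)

/-- `A` is (the trace of) a simple polygonal curve from `p` to `q`: there are corners
`p = x 0, x 1, …, x n = q` such that `A` is the union of the non-degenerate segments
`[x i, x (i + 1)]`, where two consecutive segments share only their common corner and two
non-consecutive ones are disjoint. -/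
def IsPolygonalArc (p q : Plane) (A : Set Plane) : Prop :=
  ∃ (n : ℕ) (x : ℕ → Plane),
    0 < n ∧ x 0 = p ∧ x n = q ∧
    A = ⋃ i ∈ Set.Iio n, segment ℝ (x i) (x (i + 1)) ∧
    (∀ i, i < n → x i ≠ x (i + 1)) ∧
    (∀ i, i + 1 < n →
      segment ℝ (x i) (x (i + 1)) ∩ segment ℝ (x (i + 1)) (x (i + 2)) = {x (i + 1)}) ∧
    (∀ i j, i + 1 < j → j < n →
      Disjoint (segment ℝ (x i) (x (i + 1))) (segment ℝ (x j) (x (j + 1))))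

namespace Graph

/-- The degree of a vertex, with multiplicities (a loop would count twice). -/
noncomputable def eDegree {α β : Type*} (G : Graph α β) (x : α) : ℕ∞ :=
  (G.incidenceSet x).encard + (G.loopSet x).encard

/-- Every vertex has degree `k`. -/
def IsRegularOfDegree {α β : Type*} (G : Graph α β) (k : ℕ) : Prop :=
  ∀ x ∈ G.vertexSet, G.eDegree x = k

/-- A drawing without crossings of a (loopless) multigraph in the plane: distinct vertices are
distinct points, the edges are simple polygonal curves joining their ends, a curve meets no vertices
but its ends, and the curves of two distinct edges meet only in common ends. -/
structure PlaneEmbedding {α β : Type*} (G : Graph α β) where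
  /-- The point at which a vertex is drawn. -/
  point : α → Plane
  /-- The curve by which an edge is drawn. -/
  curve : β → Set Plane
  point_injOn : Set.InjOn point G.vertexSet
  isPolygonalArc : ∀ e x y, G.IsLink e x y → IsPolygonalArc (point x) (point y) (curve e)
  inc_of_point_mem : ∀ e ∈ G.edgeSet, ∀ z ∈ G.vertexSet, point z ∈ curve e → G.Inc e z
  eq_point_of_mem_of_mem : ∀ e ∈ G.edgeSet, ∀ f ∈ G.edgeSet, e ≠ f →
    ∀ p, p ∈ curve e → p ∈ curve f → ∃ z, G.Inc e z ∧ G.Inc f z ∧ p = point z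

/-- A (loopless) multigraph is planar if it can be drawn in the plane without crossings. -/
def IsPlanar {α β : Type*} (G : Graph α β) : Prop := Nonempty G.PlaneEmbedding

/-- `c 0, e 0, c 1, e 1, …, c n, e n` (and back to `c 0`; addition in `Fin (n + 1)` is cyclic) is a
cycle of length `n + 1`, without repeated vertices or edges. Two parallel edges form a cycle of
length 2, while a single edge does not. -/
def IsCycle {α β : Type*} (G : Graph α β) {n : ℕ} (c : Fin (n + 1) → α) (e : Fin (n + 1) → β) :
    Prop :=
  Function.Injective c ∧ Function.Injective e ∧ ∀ i, G.IsLink (e i) (c i) (c (i + 1))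

/-- The interval function of the cycle convexity: `S` together with all vertices `v` such that
the subgraph induced by `S ∪ {v}` has a cycle through `v`. -/
def cycleInterval {α β : Type*} (G : Graph α β) (S : Set α) : Set α :=
  S ∪ {v | ∃ (n : ℕ) (c : Fin (n + 1) → α) (e : Fin (n + 1) → β),
    G.IsCycle c e ∧ v ∈ Set.range c ∧ Set.range c ⊆ insert v S}

/-- The convex sets of vertices in the cycle convexity. -/
def IsCycleConvex {α β : Type*} (G : Graph α β) (S : Set α) : Prop :=
  S ⊆ G.vertexSet ∧ G.cycleInterval S = S

/-- The convex hull of `S` in the cycle convexity: the intersection of all convex sets that contain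
`S`. -/
def cycleHull {α β : Type*} (G : Graph α β) (S : Set α) : Set α :=
  ⋂₀ {C | G.IsCycleConvex C ∧ S ⊆ C}

/-- The convex hull of a set of vertices is the smallest convex set containing it. -/
theorem isLeast_cycleHull {α β : Type*} (G : Graph α β) {S : Set α} (hS : S ⊆ G.vertexSet) :
    IsLeast {C | G.IsCycleConvex C ∧ S ⊆ C} (G.cycleHull S) := by
  have hV : G.IsCycleConvex G.vertexSet := by
    refine ⟨subset_rfl, Set.Subset.antisymm ?_ Set.subset_union_left⟩
    rintro v (hv | ⟨n, c, e, hc, ⟨i, rfl⟩, -⟩)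
    · exact hv
    · exact (hc.2.2 i).left_mem
  refine ⟨⟨⟨Set.sInter_subset_of_mem ⟨hV, hS⟩, Set.Subset.antisymm ?_ Set.subset_union_left⟩,
    Set.subset_sInter fun C hC => hC.2⟩, fun C hC => Set.sInter_subset_of_mem hC⟩
  rintro v (hv | ⟨n, c, e, hc, hvc, hcs⟩)
  · exact hv
  · intro C hC
    rw [← hC.1.2]
    exact Or.inr ⟨n, c, e, hc, hvc,
      hcs.trans (Set.insert_subset_insert (Set.sInter_subset_of_mem hC))⟩

/-- `S` is a hull set if it is a set of vertices whose convex hull is the whole vertex set. -/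
def IsCycleHullSet {α β : Type*} (G : Graph α β) (S : Set α) : Prop :=
  S ⊆ G.vertexSet ∧ G.cycleHull S = G.vertexSet

/-- The hull number in the cycle convexity: the least cardinality of a hull set. (In a finite graph
the vertex set itself is a finite hull set.) -/
noncomputable def cycleHullNumber {α β : Type*} (G : Graph α β) : ℕ :=
  sInf {k : ℕ | ∃ S : Set α, G.IsCycleHullSet S ∧ S.encard = k}

end Graph

/-! Planarity plays no part in the upper bound: every finite loopless `4`-regular multigraph `G` with
`n` vertices has a hull set of at most `n / 2` vertices.

Choose a root in each connected component and list the vertices by decreasing distance to the root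
of their component. Every vertex other than a root then has an edge to a later vertex, hence at most
three edges to earlier ones. Go through the list, with `X` the set of vertices already met, and let a
new vertex `w` have `b` edges to `X`, ending in `r` connected components of `G[X]`. If `b > r`, two of
these edges end in the same component and lie on a cycle in `G[X ∪ {w}]`, so `w` is in the hull of `X`
at no cost (`mem_of_isCycleConvex_of_reachable`). Otherwise `b = r`, and `w` is put into the set `S`
under construction.

Write `c(X)` for the number of components of `G[X]` and `e(X)` for the number of its edges. The step
changes `c(X) + e(X)` by at most `1 - r + b`. If `w` is put into `S`, this is `1`, so
`2|S| + c(X) + e(X)` grows by at most `3`. If `w` comes for free, then `r ≥ 1`, so it grows by at most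
`b ≤ 3`, or by `4` if `w` is a root. Hence `2|S| + c(X) + e(X) ≤ 3|X| + ρ`, where `ρ` is the number
of roots in `X` (`exists_generating_subset`). For `X = V(G)` we have `e = 2n` and `c ≥ ρ`, so
`2|S| ≤ n`.

Equality holds for two vertices joined by four parallel edges, since the empty set is convex and so
the hull number is positive. -/

/-! ### Cycles through a new vertex -/

namespace Graph

variable {α β : Type*} {G : Graph α β}

/-- The simple graph underlying `G[X]`, kept on the vertex type `α` (so the elements outside `X` are
isolated in it). -/
def inducedSimple (G : Graph α β) (X : Finset α) : SimpleGraph α where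
  Adj x y := x ≠ y ∧ x ∈ X ∧ y ∈ X ∧ ∃ e, G.IsLink e x y
  symm := ⟨fun _ _ ⟨hne, hx, hy, e, he⟩ => ⟨hne.symm, hy, hx, e, he.symm⟩⟩
  loopless := ⟨fun _ h => h.1 rfl⟩

theorem inducedSimple_mono {X Y : Finset α} (h : X ⊆ Y) :
    G.inducedSimple X ≤ G.inducedSimple Y :=
  fun _ _ ⟨hne, hx, hy, he⟩ => ⟨hne, h hx, h hy, he⟩

theorem isCycle_of_injective {n : ℕ} (hn : 2 ≤ n) {c : Fin (n + 1) → α} {e : Fin (n + 1) → β}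
    (hc : Function.Injective c) (he : ∀ i, G.IsLink (e i) (c i) (c (i + 1))) : G.IsCycle c e := by
  refine ⟨hc, fun i j hij => ?_, he⟩
  have hj := he j
  rw [← hij] at hj
  rcases (he i).eq_and_eq_or_eq_and_eq hj with ⟨h, -⟩ | ⟨h, h'⟩
  · exact hc h
  · -- otherwise `i = j + 1` and `j = i + 1`, so `n + 1` divides `2`
    exfalso
    have h1 := hc h
    have h2 := hc h'
    rw [h1, add_assoc, add_eq_left] at h2
    have h3 := congrArg Fin.val h2
    rw [Fin.val_add, Fin.val_one', Nat.mod_eq_of_lt (by lia : 1 < n + 1)] at h3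
    rw [Nat.mod_eq_of_lt (by lia : 1 + 1 < n + 1)] at h3
    simp at h3

/-- Two distinct edges from `w` to one connected component of `G[X]` lie on a cycle whose vertices
other than `w` belong to `X`. -/
theorem mem_of_isCycleConvex_of_reachable {X : Finset α} {C : Set α} (hC : G.IsCycleConvex C)
    (hXC : (X : Set α) ⊆ C) {w x y : α} (hw : w ∉ X) (hx : x ∈ X) {e e' : β}
    (hne : e ≠ e') (he : G.IsLink e w x) (he' : G.IsLink e' w y)
    (hr : (G.inducedSimple X).Reachable x y) : w ∈ C := by
  rw [← hC.2]
  obtain ⟨p, hp⟩ := hr.exists_isPath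
  have hinj := hp.getVert_injOn
  have hmem : ∀ i ≤ p.length, p.getVert i ∈ X := by
    intro i hi
    rcases Nat.eq_zero_or_pos p.length with h0 | h0
    · obtain rfl : i = 0 := by lia
      simpa using hx
    · rcases hi.lt_or_eq with h | h
      · exact (p.adj_getVert_succ h).2.1
      · have := (p.adj_getVert_succ (i := i - 1) (by lia)).2.2.1
        rwa [Nat.sub_add_cancel (by lia)] at this
  have hedge : ∀ i, ∃ b, i < p.length → G.IsLink b (p.getVert i) (p.getVert (i + 1)) := by
    intro i
    by_cases hi : i < p.length
    · obtain ⟨-, -, -, b, hb⟩ := p.adj_getVert_succ hi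
      exact ⟨b, fun _ => hb⟩
    · exact ⟨e, fun h => absurd h hi⟩
  choose b hb using hedge
  -- the path from `x` to `y`, followed by `w`
  let c : Fin (p.length + 1 + 1) → α := fun i => if i.val ≤ p.length then p.getVert i else w
  let d : Fin (p.length + 1 + 1) → β := fun i =>
    if i.val < p.length then b i else if i.val = p.length then e' else e
  have hcinj : Function.Injective c := by
    intro i j hij
    simp only [c] at hij
    apply Fin.ext
    split_ifs at hij with h1 h2 h2
    · exact hinj h1 h2 hij
    · exact absurd (hij ▸ hmem _ h1) hw
    · exact absurd (hij ▸ hmem _ h2) hw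
    · lia
  have hlink : ∀ i, G.IsLink (d i) (c i) (c (i + 1)) := by
    intro i
    have hi := i.isLt
    rcases lt_trichotomy i.val p.length with h | h | h
    · have hs : (i + 1).val = i.val + 1 := by
        rw [Fin.val_add, Fin.val_one', Nat.mod_eq_of_lt (by lia : 1 < p.length + 1 + 1),
          Nat.mod_eq_of_lt (by lia)]
      simp only [c, d, hs, if_pos h, if_pos h.le, if_pos (show i.val + 1 ≤ p.length by lia)]
      exact hb _ h
    · have hs : (i + 1).val = i.val + 1 := by
        rw [Fin.val_add, Fin.val_one', Nat.mod_eq_of_lt (by lia : 1 < p.length + 1 + 1),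
          Nat.mod_eq_of_lt (by lia)]
      simp only [c, d, hs, h, lt_irrefl, if_true, if_false, le_refl,
        if_neg (show ¬ p.length + 1 ≤ p.length by lia), SimpleGraph.Walk.getVert_length]
      exact he'.symm
    · have hs : (i + 1).val = 0 := by
        rw [Fin.val_add, Fin.val_one', Nat.mod_eq_of_lt (by lia : 1 < p.length + 1 + 1),
          show i.val + 1 = p.length + 1 + 1 by lia, Nat.mod_self]
      simp only [c, d, hs, if_neg (show ¬ i.val ≤ p.length by lia), Nat.zero_le, if_true,
        if_neg (show ¬ i.val < p.length by lia), if_neg (show ¬ i.val = p.length by lia),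
        SimpleGraph.Walk.getVert_zero]
      exact he
  have hcyc : G.IsCycle c d := by
    -- if `x = y`, the cycle consists of the parallel edges `e` and `e'`
    rcases Nat.eq_zero_or_pos p.length with h0 | h0
    · refine ⟨hcinj, fun i j hij => Fin.ext ?_, hlink⟩
      have hi := i.isLt
      have hj := j.isLt
      simp only [d, h0, Nat.not_lt_zero, if_false] at hij
      split_ifs at hij with h1 h2 h2
      · lia
      · exact absurd hij.symm hne
      · exact absurd hij hne
      · lia
    · exact isCycle_of_injective (by lia) hcinj hlink
  refine Or.inr ⟨_, c, d, hcyc, ⟨Fin.last _, ?_⟩, ?_⟩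
  · simp [c]
  · rintro _ ⟨i, rfl⟩
    by_cases h : i.val ≤ p.length
    · simp only [c, if_pos h]
      exact Or.inr (hXC (hmem _ h))
    · simp only [c, if_neg h]
      exact Or.inl rfl

/-! ### Components and edges of induced subgraphs -/

/-- The edges of `G[X]`. -/
def edgesWithin (G : Graph α β) (X : Finset α) : Set β := {e | ∃ x ∈ X, ∃ y ∈ X, G.IsLink e x y}

/-- The edges from `w` to `X`. -/
def edgesTo (G : Graph α β) (w : α) (X : Finset α) : Set β := {e | ∃ x ∈ X, G.IsLink e w x}

open Classical in
/-- The connected components of `G[X]`. -/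
noncomputable def components (G : Graph α β) (X : Finset α) :
    Finset (G.inducedSimple X).ConnectedComponent :=
  X.image (G.inducedSimple X).connectedComponentMk

open Classical in
/-- The components of `G[X]` joined to `w` by an edge. -/
noncomputable def touched (G : Graph α β) (w : α) (X : Finset α) :
    Finset (G.inducedSimple X).ConnectedComponent :=
  {x ∈ X | ∃ e, G.IsLink e w x}.image (G.inducedSimple X).connectedComponentMk

open Classical in
/-- A new vertex `w` merges the components of `G[X]` that it touches. -/
theorem card_components_insert_add_le {w : α} {X : Finset α} (hw : w ∉ X) :
    (G.components (insert w X)).card + (G.touched w X).card ≤ (G.components X).card + 1 := by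
  have hle : G.inducedSimple X ≤ G.inducedSimple (insert w X) :=
    inducedSimple_mono (Finset.subset_insert w X)
  have hsub : G.components (insert w X) ⊆
      insert ((G.inducedSimple (insert w X)).connectedComponentMk w)
        ((G.components X \ G.touched w X).image
          (SimpleGraph.ConnectedComponent.map (SimpleGraph.Hom.ofLE hle))) := by
    intro K hK
    obtain ⟨x, hx, rfl⟩ := Finset.mem_image.1 hK
    rcases Finset.mem_insert.1 hx with rfl | hxX
    · exact Finset.mem_insert_self _ _
    by_cases ht : (G.inducedSimple X).connectedComponentMk x ∈ G.touched w X
    · obtain ⟨y, hy, hyx⟩ := Finset.mem_image.1 ht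
      obtain ⟨hyX, e, he⟩ := Finset.mem_filter.1 hy
      rw [Finset.mem_insert]
      left
      rw [SimpleGraph.ConnectedComponent.eq]
      have h1 := (SimpleGraph.ConnectedComponent.eq.1 hyx).symm.mono hle
      refine h1.trans (SimpleGraph.Adj.reachable ?_)
      exact ⟨fun h => hw (h ▸ hyX), Finset.mem_insert_of_mem hyX, Finset.mem_insert_self _ _, e,
        he.symm⟩
    · refine Finset.mem_insert_of_mem (Finset.mem_image.2
        ⟨(G.inducedSimple X).connectedComponentMk x, Finset.mem_sdiff.2 ⟨?_, ht⟩, rfl⟩)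
      exact Finset.mem_image_of_mem _ hxX
  have hT : G.touched w X ⊆ G.components X :=
    Finset.image_subset_image (Finset.filter_subset _ _)
  have h1 := (Finset.card_le_card hsub).trans (Finset.card_insert_le _ _)
  have h2 := Finset.card_image_le (s := G.components X \ G.touched w X)
    (f := SimpleGraph.ConnectedComponent.map (SimpleGraph.Hom.ofLE hle))
  have h3 := Finset.card_sdiff_add_card_eq_card hT
  lia

theorem edgesWithin_insert_subset [G.Loopless] [DecidableEq α] (w : α) (X : Finset α) :
    G.edgesWithin (insert w X) ⊆ G.edgesWithin X ∪ G.edgesTo w X := by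
  rintro e ⟨x, hx, y, hy, he⟩
  rcases Finset.mem_insert.1 hx with hxw | hxX <;> rcases Finset.mem_insert.1 hy with hyw | hyX
  · exact absurd (hxw.trans hyw.symm) he.ne
  · exact Or.inr ⟨y, hyX, hxw ▸ he⟩
  · exact Or.inr ⟨x, hxX, hyw ▸ he.symm⟩
  · exact Or.inl ⟨x, hxX, y, hyX, he⟩

/-- Either every component of `G[X]` receives at most one edge from `w`, or `w` lies in every convex
set containing `X`. -/
theorem ncard_edgesTo_le_card_touched_or {w : α} {X : Finset α} (hE : G.edgeSet.Finite)
    (hw : w ∉ X) : (G.edgesTo w X).ncard ≤ (G.touched w X).card ∨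
      ((G.touched w X).card ≠ 0 ∧
        ∀ C, G.IsCycleConvex C → (X : Set α) ⊆ C → w ∈ C) := by
  classical
  rw [or_iff_not_imp_left, not_le]
  intro hlt
  have hfin : (G.edgesTo w X).Finite := hE.subset fun e ⟨x, _, he⟩ => he.edge_mem
  have hend : ∀ e, ∃ x, e ∈ G.edgesTo w X → x ∈ X ∧ G.IsLink e w x := by
    intro e
    by_cases he : e ∈ G.edgesTo w X
    · obtain ⟨x, hx⟩ := he
      exact ⟨x, fun _ => hx⟩
    · exact ⟨w, fun h => absurd h he⟩
  choose t ht using hend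
  have hmaps : ∀ e ∈ hfin.toFinset,
      (G.inducedSimple X).connectedComponentMk (t e) ∈ G.touched w X := by
    intro e he
    have := ht e (hfin.mem_toFinset.1 he)
    exact Finset.mem_image_of_mem _ (Finset.mem_filter.2 ⟨this.1, e, this.2⟩)
  rw [Set.ncard_eq_toFinset_card _ hfin] at hlt
  obtain ⟨e, he, e', he', hne, hcomp⟩ :=
    Finset.exists_ne_map_eq_of_card_lt_of_maps_to hlt hmaps
  refine ⟨Finset.card_ne_zero_of_mem (hmaps e he), fun C hC hXC => ?_⟩
  have h1 := ht e (hfin.mem_toFinset.1 he)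
  have h2 := ht e' (hfin.mem_toFinset.1 he')
  exact mem_of_isCycleConvex_of_reachable hC hXC hw h1.1 hne h1.2 h2.2
    (SimpleGraph.ConnectedComponent.eq.1 hcomp)

/-! ### Counting edges in regular multigraphs -/

theorem IsRegularOfDegree.ncard_incidenceSet [G.Loopless] {k : ℕ} (hG : G.IsRegularOfDegree k)
    {x : α} (hx : x ∈ G.vertexSet) : (G.incidenceSet x).ncard = k := by
  have h := hG x hx
  have hl : G.loopSet x = ∅ := by
    ext e
    simp
  rw [eDegree, hl, Set.encard_empty, add_zero] at h
  rw [Set.ncard, h, ENat.toNat_natCast]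

/-- The handshake lemma. -/
theorem IsRegularOfDegree.mul_card_vertexSet [G.Loopless] {k : ℕ} (hG : G.IsRegularOfDegree k)
    (hV : G.vertexSet.Finite) (hE : G.edgeSet.Finite) :
    k * hV.toFinset.card = 2 * hE.toFinset.card := by
  classical
  have h := Finset.sum_card_bipartiteAbove_eq_sum_card_bipartiteBelow
    (s := hV.toFinset) (t := hE.toFinset) (fun x e => G.Inc e x)
  rw [Finset.sum_const_nat (m := k), Finset.sum_const_nat (m := 2)] at h
  · lia
  · intro e he
    obtain ⟨x, y, hxy⟩ := exists_isLink_of_mem_edgeSet (hE.mem_toFinset.1 he)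
    rw [show Finset.bipartiteBelow (fun x e => G.Inc e x) hV.toFinset e = {x, y} from ?_,
      Finset.card_pair hxy.ne]
    ext z
    simp only [Finset.mem_bipartiteBelow, Set.Finite.mem_toFinset, Finset.mem_insert,
      Finset.mem_singleton]
    constructor
    · rintro ⟨-, hz⟩
      exact hz.eq_or_eq_of_isLink hxy
    · rintro (rfl | rfl)
      · exact ⟨hxy.left_mem, hxy.inc_left⟩
      · exact ⟨hxy.right_mem, hxy.inc_right⟩
  · intro x hx
    rw [← hG.ncard_incidenceSet (hV.mem_toFinset.1 hx), ← Set.ncard_coe_finset]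
    congr 1
    ext e
    simp only [Finset.mem_coe, Finset.mem_bipartiteAbove, Set.Finite.mem_toFinset,
      mem_incidenceSet]
    exact ⟨fun h => h.2, fun h => ⟨h.edge_mem, h⟩⟩

/-! ### The upper bound -/

open Classical in
/-- The greedy construction of a hull set. The elements of `X` are added in the order of decreasing
rank `d`, so that an element of `X` with a neighbour of smaller rank has at most three edges to the
elements added before it. An element is put into `S` only if it has at most one edge to each
component of what is there already. -/
theorem exists_generating_subset [G.Loopless] (hE : G.edgeSet.Finite)
    (hG : G.IsRegularOfDegree 4) (d : α → ℕ) (R : Finset α) (X : Finset α)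
    (hX : (X : Set α) ⊆ G.vertexSet)
    (hd : ∀ x ∈ X, x ∉ R → ∃ e y, G.IsLink e x y ∧ d y < d x) :
    ∃ S ⊆ X, (∀ C, G.IsCycleConvex C → (S : Set α) ⊆ C → (X : Set α) ⊆ C) ∧
      2 * S.card + (G.components X).card + (G.edgesWithin X).ncard ≤
        3 * X.card + (X ∩ R).card := by
  induction X using Finset.induction_on_min_value d with
  | empty =>
    refine ⟨∅, subset_rfl, by simp, ?_⟩
    simp [components, edgesWithin]
  | insert w X hw hmin ih =>
    obtain ⟨S, hSX, hS, hcard⟩ := ih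
      (fun x hx => hX (Finset.mem_coe.2 (Finset.mem_insert_of_mem hx)))
      (fun x hx => hd x (Finset.mem_insert_of_mem hx))
    have hwV : w ∈ G.vertexSet := hX (Finset.mem_coe.2 (Finset.mem_insert_self w X))
    have hwS : w ∉ S := fun h => hw (hSX h)
    have hcomp := card_components_insert_add_le (G := G) hw
    have hedge : (G.edgesWithin (insert w X)).ncard ≤
        (G.edgesWithin X).ncard + (G.edgesTo w X).ncard := by
      refine (Set.ncard_le_ncard (edgesWithin_insert_subset w X) (hE.subset ?_)).trans
        (Set.ncard_union_le _ _)
      rintro e (⟨x, _, y, _, he⟩ | ⟨x, _, he⟩) <;> exact he.edge_mem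
    have hfin : (G.incidenceSet w).Finite := hE.subset (G.incidenceSet_subset_edgeSet w)
    have hsub : G.edgesTo w X ⊆ G.incidenceSet w := fun e ⟨x, _, he⟩ => he.inc_left
    have hinc := hG.ncard_incidenceSet hwV
    have hback : (G.edgesTo w X).ncard + (X ∩ R).card ≤ 3 + (insert w X ∩ R).card := by
      by_cases hwR : w ∈ R
      · rw [Finset.insert_inter_of_mem hwR,
          Finset.card_insert_of_notMem fun h => hw (Finset.mem_inter.1 h).1]
        have := Set.ncard_le_ncard hsub hfin
        lia
      · rw [Finset.insert_inter_of_notMem hwR]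
        obtain ⟨e, y, he, hy⟩ := hd w (Finset.mem_insert_self w X) hwR
        have hss : G.edgesTo w X ⊂ G.incidenceSet w := by
          refine (Set.ssubset_iff_of_subset hsub).2 ⟨e, he.inc_left, ?_⟩
          rintro ⟨x, hx, hex⟩
          obtain rfl := hex.right_unique he
          exact absurd hy (not_lt.2 (hmin x hx))
        have := Set.ncard_lt_ncard hss hfin
        lia
    have hcardX : (insert w X).card = X.card + 1 := Finset.card_insert_of_notMem hw
    have hcardR : (X ∩ R).card ≤ (insert w X ∩ R).card :=
      Finset.card_le_card (Finset.inter_subset_inter_right (Finset.subset_insert w X))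
    -- in the first case `w` is put into `S`, in the second it comes for free
    rcases ncard_edgesTo_le_card_touched_or hE hw with hle | ⟨hne, hgen⟩
    · refine ⟨insert w S, Finset.insert_subset_insert w hSX, fun C hC hSC => ?_, ?_⟩
      · rw [Finset.coe_insert, Set.insert_subset_iff] at hSC ⊢
        exact ⟨hSC.1, hS C hC hSC.2⟩
      · rw [Finset.card_insert_of_notMem hwS]
        lia
    · refine ⟨S, hSX.trans (Finset.subset_insert w X), fun C hC hSC => ?_, ?_⟩
      · rw [Finset.coe_insert, Set.insert_subset_iff]
        exact ⟨hgen C hC (hS C hC hSC), hS C hC hSC⟩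
      · lia

/-- The bound holds for every finite loopless `4`-regular multigraph, planar or not. -/
theorem two_mul_cycleHullNumber_le [G.Loopless] (hV : G.vertexSet.Finite) (hE : G.edgeSet.Finite)
    (hG : G.IsRegularOfDegree 4) : 2 * G.cycleHullNumber ≤ G.vertexSet.ncard := by
  classical
  set V := hV.toFinset with hVdef
  have hmemV : ∀ {x}, x ∈ V ↔ x ∈ G.vertexSet := hV.mem_toFinset
  set H := G.inducedSimple V with hH
  -- the chosen representatives of the connected components serve as roots
  let root : α → α := fun x => (H.connectedComponentMk x).out
  have hroot : ∀ x, H.Reachable x (root x) := fun x =>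
    (SimpleGraph.ConnectedComponent.eq.1 (Quot.out_eq (H.connectedComponentMk x))).symm
  let R : Finset α := {x ∈ V | root x = x}
  have hd : ∀ x ∈ V, x ∉ R → ∃ e y, G.IsLink e x y ∧ H.dist y (root y) < H.dist x (root x) := by
    intro x hx hxR
    have hne : x ≠ root x := fun h => hxR (Finset.mem_filter.2 ⟨hx, h.symm⟩)
    obtain ⟨p, hp⟩ := (hroot x).exists_walk_length_eq_dist
    obtain ⟨y, hxy, q, rfl⟩ := SimpleGraph.Walk.exists_eq_cons_of_ne hne p
    obtain ⟨e, he⟩ := hxy.2.2.2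
    have hry : root y = root x := by
      simp only [root]
      rw [SimpleGraph.ConnectedComponent.eq.2 hxy.reachable]
    refine ⟨e, y, he, ?_⟩
    rw [hry, ← hp, SimpleGraph.Walk.length_cons]
    exact Nat.lt_succ_of_le (SimpleGraph.dist_le q)
  obtain ⟨S, hSV, hS, hcard⟩ := exists_generating_subset hE hG (fun x => H.dist x (root x)) R V
    (fun x hx => hmemV.1 hx) hd
  have hR : (V ∩ R).card ≤ (G.components V).card := by
    refine Finset.card_le_card_of_injOn H.connectedComponentMk
      (fun x hx => Finset.mem_image_of_mem _ (Finset.mem_inter.1 hx).1) ?_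
    intro x hx y hy hxy
    have hx' := (Finset.mem_filter.1 (Finset.mem_inter.1 hx).2).2
    have hy' := (Finset.mem_filter.1 (Finset.mem_inter.1 hy).2).2
    rw [← hx', ← hy']
    simp only [root, hxy]
  have hEV : G.edgesWithin V = G.edgeSet := by
    ext e
    constructor
    · rintro ⟨x, _, y, _, he⟩
      exact he.edge_mem
    · intro he
      obtain ⟨x, y, hxy⟩ := exists_isLink_of_mem_edgeSet he
      exact ⟨x, hmemV.2 hxy.left_mem, y, hmemV.2 hxy.right_mem, hxy⟩
  have hshake := hG.mul_card_vertexSet hV hE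
  rw [hEV, Set.ncard_eq_toFinset_card _ hE] at hcard
  have hSsub : (S : Set α) ⊆ G.vertexSet := fun x hx => hmemV.1 (hSV hx)
  have hhull : G.IsCycleHullSet S := by
    refine ⟨hSsub, Set.Subset.antisymm (G.isLeast_cycleHull hSsub).1.1.1 ?_⟩
    rintro x hx C ⟨hC, hSC⟩
    exact hS C hC hSC (Finset.mem_coe.2 (hmemV.2 hx))
  have hle : G.cycleHullNumber ≤ S.card :=
    Nat.sInf_le ⟨S, hhull, Set.encard_coe_eq_coe_finsetCard S⟩
  rw [Set.ncard_eq_toFinset_card _ hV]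
  lia

end Graph

/-! ### The extremal example -/

/-- A polygonal arc with the single inner corner `m`. -/
theorem isPolygonalArc_union_segment {p m q : Plane} (hpm : p ≠ m) (hmq : m ≠ q)
    (h : segment ℝ p m ∩ segment ℝ m q = {m}) :
    IsPolygonalArc p q (segment ℝ p m ∪ segment ℝ m q) := by
  refine ⟨2, fun i => if i = 0 then p else if i = 1 then m else q, by simp, by simp, by simp,
    ?_, ?_, ?_, ?_⟩
  · ext z
    simp only [Set.mem_iUnion, Set.mem_Iio, Set.mem_union, exists_prop]
    constructor
    · rintro (hz | hz)
      · exact ⟨0, by simp, by simpa using hz⟩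
      · exact ⟨1, by simp, by simpa using hz⟩
    · rintro ⟨i, hi, hz⟩
      interval_cases i
      · exact Or.inl (by simpa using hz)
      · exact Or.inr (by simpa using hz)
  · intro i hi
    interval_cases i
    · simpa using hpm
    · simpa using hmq
  · intro i hi
    obtain rfl : i = 0 := by lia
    simpa using h
  · intro i j hij hj
    lia

/-- The point `(-1, 0)` or `(1, 0)`. -/
noncomputable def arcEnd (x : Fin 2) : Plane := !₂[if x = 0 then -1 else 1, 0]

/-- The point `(0, i)`, the middle corner of the arc that draws the edge `i`. -/
noncomputable def arcCorner (i : Fin 4) : Plane := !₂[0, (i.val : ℝ)]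

theorem exists_of_mem_segment_arcEnd_arcCorner {x : Fin 2} {i : Fin 4} {z : Plane}
    (hz : z ∈ segment ℝ (arcEnd x) (arcCorner i)) :
    ∃ t : ℝ, 0 ≤ t ∧ t ≤ 1 ∧ z = !₂[t * (if x = 0 then -1 else 1), (1 - t) * (i.val : ℝ)] := by
  obtain ⟨a, b, ha, hb, hab, rfl⟩ := hz
  refine ⟨a, ha, by linarith, ?_⟩
  obtain rfl : b = 1 - a := by linarith
  ext k
  fin_cases k <;> simp [arcEnd, arcCorner]

theorem arcEnd_injective : Function.Injective arcEnd := by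
  intro x y h
  have h0 := congrArg (fun p : Plane => p 0) h
  fin_cases x <;> fin_cases y <;> simp [arcEnd] at h0 ⊢ <;> norm_num at h0

theorem arcEnd_ne_arcCorner (x : Fin 2) (i : Fin 4) : arcEnd x ≠ arcCorner i := by
  intro h
  have h0 := congrArg (fun p : Plane => p 0) h
  fin_cases x <;> simp [arcEnd, arcCorner] at h0

theorem segment_inter_segment_arcCorner {x y : Fin 2} (hxy : x ≠ y) (i : Fin 4) :
    segment ℝ (arcEnd x) (arcCorner i) ∩ segment ℝ (arcCorner i) (arcEnd y) = {arcCorner i} := by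
  ext z
  constructor
  · rintro ⟨hx, hy⟩
    rw [segment_symm] at hy
    obtain ⟨t, ht0, ht1, rfl⟩ := exists_of_mem_segment_arcEnd_arcCorner hx
    obtain ⟨u, hu0, hu1, hu⟩ := exists_of_mem_segment_arcEnd_arcCorner hy
    have h0 : t * (if x = 0 then -1 else 1) = u * (if y = 0 then -1 else 1) := by
      simpa using congrArg (fun p : Plane => p 0) hu
    have ht : t = 0 := by
      fin_cases x <;> fin_cases y <;> simp at hxy h0 <;> linarith
    simp [ht, arcCorner]
  · rintro rfl
    exact ⟨right_mem_segment _ _ _, left_mem_segment _ _ _⟩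

/-- Arcs through distinct corners meet only in their ends: the first coordinate `±t` determines
`t`, and `(1 - t) * i = (1 - t) * j` then forces `t = 1`. -/
theorem eq_arcEnd_of_mem_of_mem {x y : Fin 2} {i j : Fin 4} (hij : i ≠ j) {z : Plane}
    (hx : z ∈ segment ℝ (arcEnd x) (arcCorner i)) (hy : z ∈ segment ℝ (arcEnd y) (arcCorner j)) :
    z = arcEnd x := by
  obtain ⟨t, ht0, ht1, rfl⟩ := exists_of_mem_segment_arcEnd_arcCorner hx
  obtain ⟨u, hu0, hu1, hu⟩ := exists_of_mem_segment_arcEnd_arcCorner hy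
  have h0 : t * (if x = 0 then -1 else 1) = u * (if y = 0 then -1 else 1) := by
    simpa using congrArg (fun p : Plane => p 0) hu
  have h1 : (1 - t) * (i.val : ℝ) = (1 - u) * (j.val : ℝ) := by
    simpa using congrArg (fun p : Plane => p 1) hu
  have htu : t = u := by
    fin_cases x <;> fin_cases y <;> simp at h0 <;> linarith
  subst htu
  have hne : (i.val : ℝ) - j.val ≠ 0 := by
    rw [sub_ne_zero]
    exact fun h => hij (Fin.ext (Nat.cast_injective h))
  have ht : t = 1 := by
    have : (1 - t) * ((i.val : ℝ) - j.val) = 0 := by linarith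
    rcases mul_eq_zero.1 this with h | h
    · linarith
    · exact absurd h hne
  simp [ht, arcEnd]

namespace Graph

/-- Both vertices of the extremal graph are ends of each of its edges. -/
theorem banana_inc_of_fin_two (e : Fin 4) (z : Fin 2) :
    (banana (0 : Fin 2) 1 (Set.univ : Set (Fin 4))).Inc e z := by
  rw [banana_inc]
  refine ⟨trivial, ?_⟩
  fin_cases z <;> simp

theorem banana_loopless : (banana (0 : Fin 2) 1 (Set.univ : Set (Fin 4))).Loopless :=
  ⟨fun e x => by simp⟩

theorem banana_isRegularOfDegree :
    (banana (0 : Fin 2) 1 (Set.univ : Set (Fin 4))).IsRegularOfDegree 4 := by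
  intro x _
  have h1 : (banana (0 : Fin 2) 1 (Set.univ : Set (Fin 4))).incidenceSet x = Set.univ :=
    Set.eq_univ_of_forall fun e => banana_inc_of_fin_two e x
  have h2 : (banana (0 : Fin 2) 1 (Set.univ : Set (Fin 4))).loopSet x = ∅ := by
    ext e
    simp
  rw [eDegree, h1, h2, Set.encard_univ]
  simp

theorem banana_isPlanar : (banana (0 : Fin 2) 1 (Set.univ : Set (Fin 4))).IsPlanar := by
  refine ⟨⟨arcEnd, fun i => ⋃ x, segment ℝ (arcEnd x) (arcCorner i), arcEnd_injective.injOn, ?_,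
    fun e _ z _ _ => banana_inc_of_fin_two e z, ?_⟩⟩
  · intro i x y h
    have hxy : x ≠ y := by
      rcases h.2 with ⟨rfl, rfl⟩ | ⟨rfl, rfl⟩ <;> decide
    have hU : ⋃ x, segment ℝ (arcEnd x) (arcCorner i) =
        segment ℝ (arcEnd x) (arcCorner i) ∪ segment ℝ (arcCorner i) (arcEnd y) := by
      rw [segment_symm ℝ (arcCorner i)]
      ext z
      rw [Set.mem_iUnion, Fin.exists_fin_two, Set.mem_union]
      rcases h.2 with ⟨rfl, rfl⟩ | ⟨rfl, rfl⟩
      · rfl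
      · exact or_comm
    rw [hU]
    exact isPolygonalArc_union_segment (arcEnd_ne_arcCorner x i) (arcEnd_ne_arcCorner y i).symm
      (segment_inter_segment_arcCorner hxy i)
  · intro e _ f _ hef p hpe hpf
    obtain ⟨x, hx⟩ := Set.mem_iUnion.1 hpe
    obtain ⟨y, hy⟩ := Set.mem_iUnion.1 hpf
    exact ⟨x, banana_inc_of_fin_two e x, banana_inc_of_fin_two f x,
      eq_arcEnd_of_mem_of_mem hef hx hy⟩

theorem isCycleConvex_empty {α β : Type*} (G : Graph α β) [G.Loopless] : G.IsCycleConvex ∅ := by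
  refine ⟨Set.empty_subset _, Set.eq_empty_of_forall_notMem ?_⟩
  rintro v (hv | ⟨n, c, e, hc, -, hcv⟩)
  · exact hv
  · have h : ∀ i, c i = v := fun i => by simpa using hcv ⟨i, rfl⟩
    exact (hc.2.2 0).ne ((h 0).trans (h _).symm)

theorem cycleHullNumber_pos {α β : Type*} (G : Graph α β) [G.Loopless]
    (hV : G.vertexSet.Finite) (hne : G.vertexSet.Nonempty) : 0 < G.cycleHullNumber := by
  -- `V(G)` is a finite hull set, so the infimum defining the hull number is attained
  have hmem : G.cycleHullNumber ∈
      {k : ℕ | ∃ S : Set α, G.IsCycleHullSet S ∧ S.encard = k} := by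
    refine Nat.sInf_mem ⟨G.vertexSet.ncard, G.vertexSet, ⟨subset_rfl, ?_⟩, ?_⟩
    · exact Set.Subset.antisymm (G.isLeast_cycleHull subset_rfl).1.1.1
        (G.isLeast_cycleHull subset_rfl).1.2
    · exact hV.cast_ncard_eq.symm
  obtain ⟨S, hS, hcard⟩ := hmem
  refine Nat.pos_of_ne_zero fun h0 => ?_
  rw [h0, Nat.cast_zero, Set.encard_eq_zero] at hcard
  subst hcard
  have h : G.vertexSet ⊆ ∅ := by
    rw [← hS.2]
    exact Set.sInter_subset_of_mem ⟨G.isCycleConvex_empty, subset_rfl⟩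
  exact hne.not_subset_empty h

end Graph

theorem theorem3 :
    (∀ (α : Type*) (β : Type*) (G : Graph α β), G.vertexSet.Finite → G.edgeSet.Finite →
      G.Loopless → G.IsRegularOfDegree 4 → G.IsPlanar →
        (G.cycleHullNumber : ℝ) ≤ (1 / 2 : ℝ) * (G.vertexSet.ncard : ℝ)) ∧
    (∃ G : Graph (Fin 2) (Fin 4),
      G.Loopless ∧ G.IsRegularOfDegree 4 ∧ G.IsPlanar ∧ G.vertexSet.ncard = 2 ∧
        (G.cycleHullNumber : ℝ) = (1 / 2 : ℝ) * (G.vertexSet.ncard : ℝ)) := by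
  constructor
  · intro α β G hV hE _ hG _
    have h : ((2 * G.cycleHullNumber : ℕ) : ℝ) ≤ G.vertexSet.ncard :=
      Nat.cast_le.2 (Graph.two_mul_cycleHullNumber_le hV hE hG)
    push_cast at h
    linarith
  · have := Graph.banana_loopless
    have hcard : (Graph.banana (0 : Fin 2) 1 (Set.univ : Set (Fin 4))).vertexSet.ncard = 2 :=
      Set.ncard_pair (by decide)
    refine ⟨Graph.banana 0 1 Set.univ, this, Graph.banana_isRegularOfDegree,
      Graph.banana_isPlanar, hcard, ?_⟩
    have hle := Graph.two_mul_cycleHullNumber_le (Set.toFinite _) (Set.toFinite _)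
      Graph.banana_isRegularOfDegree
    have hpos := Graph.cycleHullNumber_pos (Graph.banana (0 : Fin 2) 1 (Set.univ : Set (Fin 4)))
      (Set.toFinite _) ⟨0, Or.inl rfl⟩
    have h1 : (Graph.banana (0 : Fin 2) 1 (Set.univ : Set (Fin 4))).cycleHullNumber = 1 := by
      lia
    rw [h1, hcard]
    norm_num
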